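/- Let $n\ge 1$. A Gelfand-Tsetlin triangle of size $n$ is an array $X=(X_{i,j})_{n\ge i\ge j\ge 1}$ of positive integers with $X_{i+1,j}\le X_{i,j}\le X_{i+1,j+1}$ for $n-1\ge i\ge j\ge 1$. It is a Gog triangle if moreover $X_{i,j}<X_{i,j+1}$ for $1\le j<i\le n-1$ and $X_{n,j}=j$ for $1\le j\le n$; it is a Magog triangle if moreover $X_{j,j}\le j$ for $1\le j\le n$; it is a GOGAm triangle if its image under the Schützenberger involution $S$ is a Magog triangle. Here $S=\omega_1\omega_2\cdots\omega_{n-1}$ with $\omega_m=s_m s_{m-1}\cdots s_1$ (composition of maps, the rightmost factor acting first), where $s_k$ changes only row $k$ and replaces $X_{k,j}$ by $\max(X_{k+1,j},X_{k-1,j-1})+\min(X_{k+1,j+1},X_{k-1,j})-X_{k,j}$, undefined entries being omitted from the maximum and the minimum. An inversion of $X$ is a pair $(k,l)$ with $1\le l\le k\le n-1$ and $X_{k,l}=X_{k+1,l}$; it covers the positions $(k+p,l+p)$, $1\le p\le n-k$. The standard procedure scans the inversions $(k,l)$ of $X$ by decreasing $l$ and, for equal $l$, by decreasing $k$, and for each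 of them subtracts $1$ from the entries at the positions that it covers. The triangle $X$ is called admissible if the arrays obtained after each of these steps are Gelfand-Tsetlin triangles. **Proposition.** Let $X$ be a Gog triangle of size $n$ and let $Y$ be the array obtained by applying the standard procedure to $X$. 1. One has $Y_{n,n}\le n$ and, for all $1\le k\le n-1$ and all $n=j_0>j_1>\cdots>j_{n-k}\ge 1$, $$\left(\sum_{i=0}^{n-k-1}\bigl(Y_{j_i+i,\,j_i}-Y_{j_{i+1}+i,\,j_{i+1}}\bigr)\right)+Y_{j_{n-k}+n-k,\,j_{n-k}}\le k .$$ 2. If $Y$ is a Gelfand-Tsetlin triangle, then $Y$ is a GOGAm triangle of size $n$. 3. In particular, if $X$ is admissible, then $Y$ is a GOGAm triangle of size $n$. -/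

import Mathlib

/-! A triangular array of size `n` is represented by a function `X : ℕ → ℕ → ℤ`, of which only the
entries `X i j` with `1 ≤ j ≤ i ≤ n` are relevant (row `n` is the top row, row `1` the bottom one).
All predicates below constrain, and all operations below read, only these entries. -/

/-- `X` is a Gelfand-Tsetlin triangle of size `n`. -/
def IsGelfandTsetlin (n : ℕ) (X : ℕ → ℕ → ℤ) : Prop :=
  (∀ i j, 1 ≤ j → j ≤ i → i ≤ n → 1 ≤ X i j) ∧
  (∀ i j, 1 ≤ j → j ≤ i → i + 1 ≤ n → X (i + 1) j ≤ X i j ∧ X i j ≤ X (i + 1) (j + 1))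

/-- `X` is a Gog triangle of size `n`. -/
def IsGog (n : ℕ) (X : ℕ → ℕ → ℤ) : Prop :=
  IsGelfandTsetlin n X ∧
  (∀ i j, 1 ≤ j → j < i → i + 1 ≤ n → X i j < X i (j + 1)) ∧
  (∀ j, 1 ≤ j → j ≤ n → X n j = (j : ℤ))

/-- `X` is a Magog triangle of size `n`. -/
def IsMagog (n : ℕ) (X : ℕ → ℕ → ℤ) : Prop :=
  IsGelfandTsetlin n X ∧ ∀ j, 1 ≤ j → j ≤ n → X j j ≤ (j : ℤ)

/-- The involution `s_k`: each entry of row `k` is reflected in the interval given by its neighbours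
in rows `k + 1` and `k - 1`; a neighbour that does not exist (the lower left one when `j = 1`, the
lower right one when `j = k`) is left out of the maximum or minimum. -/
def rowReflection (k : ℕ) (X : ℕ → ℕ → ℤ) : ℕ → ℕ → ℤ := fun i j =>
  if i = k ∧ 1 ≤ j ∧ j ≤ k then
    (if j = 1 then X (k + 1) j else max (X (k + 1) j) (X (k - 1) (j - 1)))
      + (if j = k then X (k + 1) (j + 1) else min (X (k + 1) (j + 1)) (X (k - 1) j))
      - X k j
  else X i j

/-- `ω_m = s_m s_{m-1} ⋯ s_1`, the factor `s_1` acting first. -/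
def omegaOp : ℕ → (ℕ → ℕ → ℤ) → (ℕ → ℕ → ℤ)
  | 0, X => X
  | m + 1, X => rowReflection (m + 1) (omegaOp m X)

/-- `ω_1 ω_2 ⋯ ω_m`, the factor `ω_m` acting first. -/
def omegaProd : ℕ → (ℕ → ℕ → ℤ) → (ℕ → ℕ → ℤ)
  | 0, X => X
  | m + 1, X => omegaProd m (omegaOp (m + 1) X)

/-- The Schützenberger involution `S = ω_1 ω_2 ⋯ ω_{n-1}` on triangles of size `n`. -/
def schutzenberger (n : ℕ) (X : ℕ → ℕ → ℤ) : ℕ → ℕ → ℤ := omegaProd (n - 1) X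

/-- `X` is a GOGAm triangle of size `n`: a Gelfand-Tsetlin triangle whose image by the
Schützenberger involution is a Magog triangle. -/
def IsGOGAm (n : ℕ) (X : ℕ → ℕ → ℤ) : Prop :=
  IsGelfandTsetlin n X ∧ IsMagog n (schutzenberger n X)

/-- The GOGAm inequalities: `X n n ≤ n` and, for all `1 ≤ k ≤ n - 1` and
`n = j_0 > j_1 > ⋯ > j_{n-k} ≥ 1`,
`∑_{i=0}^{n-k-1} (X_{j_i+i, j_i} - X_{j_{i+1}+i, j_{i+1}}) + X_{j_{n-k}+n-k, j_{n-k}} ≤ k`. -/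
def GOGAmInequalities (n : ℕ) (X : ℕ → ℕ → ℤ) : Prop :=
  X n n ≤ (n : ℤ) ∧
  ∀ k : ℕ, 1 ≤ k → k + 1 ≤ n →
    ∀ J : ℕ → ℕ, J 0 = n → (∀ i, i < n - k → J (i + 1) < J i) → 1 ≤ J (n - k) →
      (∑ i ∈ Finset.range (n - k), (X (J i + i) (J i) - X (J (i + 1) + i) (J (i + 1))))
        + X (J (n - k) + (n - k)) (J (n - k)) ≤ (k : ℤ)

/-- `(i, j)` is an inversion of the triangle `X` of size `n`. -/
def IsInversion (n : ℕ) (X : ℕ → ℕ → ℤ) (i j : ℕ) : Prop :=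
  1 ≤ j ∧ j ≤ i ∧ i + 1 ≤ n ∧ X i j = X (i + 1) j

instance (n : ℕ) (X : ℕ → ℕ → ℤ) (i j : ℕ) : Decidable (IsInversion n X i j) := by
  unfold IsInversion; infer_instance

/-- In a triangle of size `n`, an inversion at `(k, l)` covers the position `(i, j)`. -/
def Covers (n k l i j : ℕ) : Prop :=
  ∃ p ∈ Finset.Icc 1 (n - k), i = k + p ∧ j = l + p

instance (n k l i j : ℕ) : Decidable (Covers n k l i j) := by
  unfold Covers; infer_instance

/-- All the inversions of `X`, in the order in which they are scanned: along the successive NW-SE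
diagonals (on which `j` is constant), the rightmost diagonal (largest `j`) first, and each diagonal
from NW to SE (by decreasing `i`). -/
def inversionList (n : ℕ) (X : ℕ → ℕ → ℤ) : List (ℕ × ℕ) :=
  ((List.range n).reverse.flatMap fun j => (List.range n).reverse.map fun i => (i, j)).filter
    fun q => decide (IsInversion n X q.1 q.2)

/-- Subtract `1` from each entry of `Y` that an inversion at position `q` covers. -/
def subtractCovered (n : ℕ) (Y : ℕ → ℕ → ℤ) (q : ℕ × ℕ) : ℕ → ℕ → ℤ := fun i j =>
  if Covers n q.1 q.2 i j then Y i j - 1 else Y i j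

/-- The array obtained from `X` after the first `m` steps of the standard procedure. -/
def standardStep (n : ℕ) (X : ℕ → ℕ → ℤ) (m : ℕ) : ℕ → ℕ → ℤ :=
  ((inversionList n X).take m).foldl (subtractCovered n) X

/-- The array obtained by applying the standard procedure to `X`: for every inversion of `X`,
subtract `1` from the entries that it covers. -/
def standardProcedure (n : ℕ) (X : ℕ → ℕ → ℤ) : ℕ → ℕ → ℤ :=
  (inversionList n X).foldl (subtractCovered n) X

/-- `X` is admissible: after each step of the standard procedure the array is a Gelfand-Tsetlin
triangle. -/
def IsAdmissible (n : ℕ) (X : ℕ → ℕ → ℤ) : Prop :=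
  ∀ m, m ≤ (inversionList n X).length → IsGelfandTsetlin n (standardStep n X m)

/-! ### The Schützenberger involution on Gelfand-Tsetlin triangles -/

/-! Summation by parts turns the inequalities into bounds `X n n + ∑ D_i(J (i+1)) ≤ n - r` along
strictly decreasing paths, `D` being `diagonalStep`. They force the Magog bounds
(`IsGelfandTsetlin.isGOGAm`): they pass from `X` of size `m + 1` to `ω_m X` of size `m`
(`GOGAmInequalities.apply_omegaOp`), and `r = 0` bounds the corner entry at each size. The output of
the standard procedure satisfies them because a diagonal step of `X` is either negative or zero at
an inversion, which then adds a cover further along its diagonal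
(`IsGelfandTsetlin.diagonalStep_add_coverCount_le`); these estimates telescope along the path. -/

theorem rowReflection_apply_of_ne {k i : ℕ} (h : i ≠ k) (X : ℕ → ℕ → ℤ) (j : ℕ) :
    rowReflection k X i j = X i j := by
  simp [rowReflection, h]

theorem rowReflection_self {k j : ℕ} (hj : 1 ≤ j) (hjk : j ≤ k) (X : ℕ → ℕ → ℤ) :
    rowReflection k X k j =
      (if j = 1 then X (k + 1) j else max (X (k + 1) j) (X (k - 1) (j - 1)))
      + (if j = k then X (k + 1) (j + 1) else min (X (k + 1) (j + 1)) (X (k - 1) j))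
      - X k j := by
  simp [rowReflection, hj, hjk]

/-- The reflected entry stays between its upper neighbours and its existing lower neighbours. -/
theorem IsGelfandTsetlin.rowReflection_bounds {n k j : ℕ} {X : ℕ → ℕ → ℤ}
    (hX : IsGelfandTsetlin n X) (hk : k + 1 ≤ n) (hj : 1 ≤ j) (hjk : j ≤ k) :
    X (k + 1) j ≤ rowReflection k X k j ∧ rowReflection k X k j ≤ X (k + 1) (j + 1) ∧
    (1 < j → X (k - 1) (j - 1) ≤ rowReflection k X k j) ∧
    (j < k → rowReflection k X k j ≤ X (k - 1) j) := by
  rw [rowReflection_self hj hjk]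
  have h1 := hX.2 k j hj hjk hk
  have h2 : 1 < j → X k (j - 1) ≤ X (k - 1) (j - 1) ∧ X (k - 1) (j - 1) ≤ X k j := by
    intro h
    have := hX.2 (k - 1) (j - 1) (by omega) (by omega) (by omega)
    rwa [Nat.sub_add_cancel (by omega), Nat.sub_add_cancel (by omega)] at this
  have h3 : j < k → X k j ≤ X (k - 1) j := by
    intro h
    have := hX.2 (k - 1) j (by omega) (by omega) (by omega)
    rw [Nat.sub_add_cancel (by omega)] at this
    exact this.1
  by_cases hj1 : j = 1 <;> by_cases hjk' : j = k
  · rw [if_pos hj1, if_pos hjk']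
    refine ⟨by omega, by omega, by omega, by omega⟩
  · have := h3 (by omega)
    rw [if_pos hj1, if_neg hjk']
    refine ⟨by omega, by omega, by omega, by omega⟩
  · have := h2 (by omega)
    rw [if_neg hj1, if_pos hjk']
    refine ⟨by omega, by omega, by omega, by omega⟩
  · have := h2 (by omega)
    have := h3 (by omega)
    rw [if_neg hj1, if_neg hjk']
    refine ⟨by omega, by omega, by omega, by omega⟩

theorem IsGelfandTsetlin.rowReflection {n k : ℕ} {X : ℕ → ℕ → ℤ}
    (hX : IsGelfandTsetlin n X) (hk : k + 1 ≤ n) : IsGelfandTsetlin n (rowReflection k X) := by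
  refine ⟨fun i j hj hji hi => ?_, fun i j hj hji hi => ?_⟩
  · by_cases hik : i = k
    · subst hik
      exact (hX.1 (i + 1) j hj (by omega) hk).trans (hX.rowReflection_bounds hk hj hji).1
    · rw [rowReflection_apply_of_ne hik]
      exact hX.1 i j hj hji hi
  · by_cases hik : i = k
    · subst hik
      rw [rowReflection_apply_of_ne i.succ_ne_self, rowReflection_apply_of_ne i.succ_ne_self]
      have h := hX.rowReflection_bounds hk hj hji
      exact ⟨h.1, h.2.1⟩
    · by_cases hik' : i + 1 = k
      · subst hik'
        rw [rowReflection_apply_of_ne hik]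
        exact ⟨(hX.rowReflection_bounds hk hj (by omega)).2.2.2 (by omega),
          (hX.rowReflection_bounds hk (j := j + 1) (by omega) (by omega)).2.2.1 (by omega)⟩
      · rw [rowReflection_apply_of_ne hik, rowReflection_apply_of_ne hik',
          rowReflection_apply_of_ne hik']
        exact hX.2 i j hj hji hi

theorem IsGelfandTsetlin.omegaOp {n m : ℕ} {X : ℕ → ℕ → ℤ}
    (hX : IsGelfandTsetlin n X) (hm : m + 1 ≤ n) : IsGelfandTsetlin n (omegaOp m X) := by
  induction m with
  | zero => exact hX
  | succ m ih => exact (ih (by omega)).rowReflection hm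

theorem IsGelfandTsetlin.omegaProd {n m : ℕ} {X : ℕ → ℕ → ℤ}
    (hX : IsGelfandTsetlin n X) (hm : m + 1 ≤ n) : IsGelfandTsetlin n (omegaProd m X) := by
  induction m generalizing X with
  | zero => exact hX
  | succ m ih => exact ih (hX.omegaOp hm) (by omega)

theorem omegaOp_apply_of_lt {m i : ℕ} (h : m < i) (X : ℕ → ℕ → ℤ) (j : ℕ) :
    omegaOp m X i j = X i j := by
  induction m with
  | zero => rfl
  | succ m ih =>
    rw [omegaOp, rowReflection_apply_of_ne (by omega), ih (by omega)]

theorem omegaProd_apply_of_lt {m i : ℕ} (h : m < i) (X : ℕ → ℕ → ℤ) (j : ℕ) :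
    omegaProd m X i j = X i j := by
  induction m generalizing X with
  | zero => rfl
  | succ m ih =>
    rw [omegaProd, ih (by omega), omegaOp_apply_of_lt h]

theorem omegaOp_apply_of_le {m i : ℕ} (h : i ≤ m) (X : ℕ → ℕ → ℤ) (j : ℕ) :
    omegaOp m X i j = omegaOp i X i j := by
  induction m, h using Nat.le_induction with
  | base => rfl
  | succ m h ih => rw [omegaOp, rowReflection_apply_of_ne (by omega), ih]

/-- Row `i` of `ω_m X` in terms of `X` and of row `i - 1` of `ω_m X`. -/
theorem omegaOp_apply {m i j : ℕ} (hj : 1 ≤ j) (hji : j ≤ i) (him : i ≤ m) (X : ℕ → ℕ → ℤ) :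
    omegaOp m X i j =
      (if j = 1 then X (i + 1) j else max (X (i + 1) j) (omegaOp m X (i - 1) (j - 1)))
      + (if j = i then X (i + 1) (j + 1)
          else min (X (i + 1) (j + 1)) (omegaOp m X (i - 1) j))
      - X i j := by
  obtain ⟨i, rfl⟩ : ∃ k, i = k + 1 := ⟨i - 1, by omega⟩
  rw [omegaOp_apply_of_le him, omegaOp, rowReflection_self hj hji]
  simp only [Nat.add_sub_cancel, omegaOp_apply_of_le (show i ≤ m by omega),
    omegaOp_apply_of_lt (show i < i + 1 by omega),
    omegaOp_apply_of_lt (show i < i + 1 + 1 by omega)]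

/-! ### The GOGAm inequalities and their stability under `ω` -/

/-- The difference, in column `j`, of the entries on the diagonals `d + 1` and `d`. -/
def diagonalStep (X : ℕ → ℕ → ℤ) (d j : ℕ) : ℤ := X (j + d + 1) j - X (j + d) j

theorem gogam_sum_eq (X : ℕ → ℕ → ℤ) (J : ℕ → ℕ) (r : ℕ) :
    (∑ i ∈ Finset.range r, (X (J i + i) (J i) - X (J (i + 1) + i) (J (i + 1))))
        + X (J r + r) (J r) =
      X (J 0) (J 0) + ∑ i ∈ Finset.range r, diagonalStep X i (J (i + 1)) := by
  induction r with
  | zero => simp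
  | succ r ih =>
    rw [Finset.sum_range_succ, Finset.sum_range_succ, ← add_assoc (X (J 0) (J 0)), ← ih,
      diagonalStep, ← add_assoc (J (r + 1))]
    ring

theorem add_index_le_of_succ_lt {J : ℕ → ℕ} {r : ℕ} (hJ : ∀ i, i < r → J (i + 1) < J i) {i : ℕ}
    (hi : i ≤ r) : J i + i ≤ J 0 := by
  induction i with
  | zero => simp
  | succ i ih =>
    have := ih (by omega)
    have := hJ i hi
    omega

theorem last_le_of_succ_lt {J : ℕ → ℕ} {r : ℕ} (hJ : ∀ i, i < r → J (i + 1) < J i) {i : ℕ}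
    (hi : i ≤ r) : J r ≤ J i := by
  induction r, hi using Nat.le_induction with
  | base => rfl
  | succ r hi ih =>
    have := ih fun i h => hJ i (by omega)
    have := hJ r (by omega)
    omega

/-- Here `r = n - k`; the case `r = 0` absorbs the separate condition on `X n n`. -/
theorem gogamInequalities_iff {n : ℕ} (hn : 1 ≤ n) {X : ℕ → ℕ → ℤ} :
    GOGAmInequalities n X ↔
      ∀ r, r < n → ∀ J : ℕ → ℕ, J 0 = n → (∀ i, i < r → J (i + 1) < J i) → 1 ≤ J r →
        X n n + ∑ i ∈ Finset.range r, diagonalStep X i (J (i + 1)) ≤ (n : ℤ) - r := by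
  constructor
  · rintro ⟨h0, h⟩ r hr J hJ0 hJ hJr
    rcases Nat.eq_zero_or_pos r with rfl | hr0
    · simpa using h0
    · have key := h (n - r) (by omega) (by omega) J hJ0
      rw [Nat.sub_sub_self hr.le, gogam_sum_eq, hJ0] at key
      have := key hJ hJr
      push_cast [hr.le] at this
      exact this
  · intro h
    refine ⟨by simpa using h 0 hn (fun _ => n) rfl (by simp) hn, ?_⟩
    intro k hk hkn J hJ0 hJ hJr
    have key := h (n - k) (by omega) J hJ0 hJ hJr
    rw [gogam_sum_eq, hJ0]
    push_cast [show k ≤ n by omega] at key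
    linarith

/-- The lower bound in the reflection defining the entry `(j + d, j)` of `ω_m X`, minus the
corresponding entry of `X`. -/
def reflectionGain (m : ℕ) (X : ℕ → ℕ → ℤ) (d j : ℕ) : ℤ :=
  (if j = 1 then X (j + d + 1) j
    else max (X (j + d + 1) j) (omegaOp m X (j + d - 1) (j - 1))) - X (j + d) j

/-- The part of the entry `(j + d, j)` of `ω_m X` exceeding the entry `(j + d + 2, j + 1)`
of `X`. -/
def reflectionExcess (m : ℕ) (X : ℕ → ℕ → ℤ) (d j : ℕ) : ℤ :=
  if j = 0 then 0 else max 0 (omegaOp m X (j + d) j - X (j + d + 2) (j + 1))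

theorem reflectionExcess_nonneg (m : ℕ) (X : ℕ → ℕ → ℤ) (d j : ℕ) :
    0 ≤ reflectionExcess m X d j := by
  unfold reflectionExcess
  split_ifs
  · rfl
  · exact le_max_left _ _

/-- This is `max x y = x + max 0 (y - x)`; the value `0` of the excess in column `0` encodes the
omitted neighbour. -/
theorem reflectionGain_succ (m : ℕ) (X : ℕ → ℕ → ℤ) (d j : ℕ) :
    reflectionGain m X d (j + 1) = diagonalStep X d (j + 1) + reflectionExcess m X d j := by
  unfold reflectionGain reflectionExcess diagonalStep
  rw [show j + 1 + d - 1 = j + d by omega, show j + 1 + d + 1 = j + d + 2 by omega,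
    Nat.add_sub_cancel]
  rcases Nat.eq_zero_or_pos j with rfl | hj
  · simp
  · rw [if_neg (by omega), if_neg (by omega)]
    omega

theorem omegaOp_apply_self {m j : ℕ} (hj : 1 ≤ j) (hjm : j ≤ m) (X : ℕ → ℕ → ℤ) :
    omegaOp m X j j = reflectionGain m X 0 j + X (j + 1) (j + 1) := by
  rw [omegaOp_apply hj le_rfl hjm, if_pos (rfl : j = j), reflectionGain]
  simp only [add_zero]
  ring

/-- Dually, `min x y - y = -max 0 (y - x)`, where `y` is the entry of `ω_m X` being subtracted. -/
theorem diagonalStep_omegaOp {m d j : ℕ} (hj : 1 ≤ j) (hjm : j + d + 1 ≤ m) (X : ℕ → ℕ → ℤ) :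
    diagonalStep (omegaOp m X) d j =
      reflectionGain m X (d + 1) j - reflectionExcess m X d j := by
  rw [diagonalStep, omegaOp_apply hj (by omega) hjm, if_neg (show j ≠ j + d + 1 by omega),
    reflectionGain, reflectionExcess, if_neg (show j ≠ 0 by omega)]
  simp only [← add_assoc, Nat.add_sub_cancel]
  rw [show j + d + 1 + 1 = j + d + 2 by omega]
  omega

theorem omegaOp_apply_le {m d j : ℕ} (hj : 1 ≤ j) (hjm : j + d ≤ m) (X : ℕ → ℕ → ℤ) :
    omegaOp m X (j + d) j ≤ reflectionGain m X d j + X (j + d + 1) (j + 1) := by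
  rw [omegaOp_apply hj (by omega) hjm, reflectionGain]
  have : (if j = j + d then X (j + d + 1) (j + 1)
      else min (X (j + d + 1) (j + 1)) (omegaOp m X (j + d - 1) j)) ≤ X (j + d + 1) (j + 1) := by
    split_ifs
    · rfl
    · exact min_le_left _ _
  linarith

theorem reflectionGain_succ_le {m d j : ℕ} (hj : 1 ≤ j) (hjm : j + d ≤ m) (X : ℕ → ℕ → ℤ) :
    reflectionGain m X d (j + 1) ≤
      max (diagonalStep X d (j + 1)) (reflectionGain m X d j) := by
  have h := omegaOp_apply_le hj hjm X
  rw [reflectionGain_succ, reflectionExcess, if_neg (show j ≠ 0 by omega), diagonalStep]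
  rw [show j + 1 + d + 1 = j + d + 2 by omega, show j + 1 + d = j + d + 1 by omega]
  omega

/-- Going down from column `b`, either the gain is bounded by the step in the current column or it
passes to the previous one. In column `a + 1` the excess cancels exactly. -/
theorem exists_reflectionGain_sub_reflectionExcess_le {m d a b : ℕ} (hab : a < b)
    (hb : b + d ≤ m) (X : ℕ → ℕ → ℤ) :
    ∃ t, a < t ∧ t ≤ b ∧
      reflectionGain m X d b - reflectionExcess m X d a ≤ diagonalStep X d t := by
  induction b, hab using Nat.le_induction with
  | base => exact ⟨a + 1, by omega, le_rfl, by rw [reflectionGain_succ]; linarith⟩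
  | succ b hab ih =>
    rcases le_max_iff.1 (reflectionGain_succ_le (d := d) (m := m) (j := b) (by omega) (by omega) X)
      with h | h
    · refine ⟨b + 1, by omega, le_rfl, ?_⟩
      linarith [reflectionExcess_nonneg m X d a]
    · obtain ⟨t, hat, htb, ht⟩ := ih (by omega)
      exact ⟨t, hat, by omega, by linarith⟩

theorem GOGAmInequalities.apply_omegaOp {m : ℕ} (hm : 1 ≤ m) {X : ℕ → ℕ → ℤ}
    (hX : GOGAmInequalities (m + 1) X) : GOGAmInequalities m (omegaOp m X) := by
  rw [gogamInequalities_iff (by omega)] at hX ⊢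
  intro r hr J hJ0 hJ hJr
  have hlow : ∀ i, i ≤ r → 1 ≤ J i := fun i hi => hJr.trans (last_le_of_succ_lt hJ hi)
  have hup : ∀ i, i ≤ r → J i + i ≤ m := fun i hi => hJ0 ▸ add_index_le_of_succ_lt hJ hi
  -- the path `J`, followed by `0`
  set L : ℕ → ℕ := fun i => if i ≤ r then J i else 0 with hL
  have hLJ : ∀ i, i ≤ r → L i = J i := fun i hi => if_pos hi
  have hLr : L (r + 1) = 0 := if_neg (by omega)
  have hLlt : ∀ i, i ≤ r → L (i + 1) < L i := by
    intro i hi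
    rcases hi.lt_or_eq with h | rfl
    · rw [hLJ _ h, hLJ _ hi]
      exact hJ i h
    · rw [hLr, hLJ _ le_rfl]
      exact hJr
  have hex : ∀ i, ∃ t, i ≤ r → L (i + 1) < t ∧ t ≤ L i ∧
      reflectionGain m X i (L i) - reflectionExcess m X i (L (i + 1)) ≤ diagonalStep X i t := by
    intro i
    by_cases hi : i ≤ r
    · obtain ⟨t, ht⟩ := exists_reflectionGain_sub_reflectionExcess_le (m := m) (hLlt i hi)
        (by rw [hLJ i hi]; exact hup i hi) X
      exact ⟨t, fun _ => ht⟩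
    · exact ⟨0, fun h => absurd h hi⟩
  choose T hT using hex
  -- Regrouping pairs each gain with the excess at the next vertex of the path.
  have hsum : ∀ s, s ≤ r →
      omegaOp m X m m + ∑ i ∈ Finset.range s, diagonalStep (omegaOp m X) i (J (i + 1)) =
        X (m + 1) (m + 1) + ∑ i ∈ Finset.range s,
          (reflectionGain m X i (L i) - reflectionExcess m X i (L (i + 1)))
          + reflectionGain m X s (L s) := by
    intro s hs
    induction s with
    | zero =>
      rw [hLJ 0 hs, hJ0, omegaOp_apply_self hm le_rfl]
      simp [add_comm]
    | succ s ih =>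
      rw [Finset.sum_range_succ, Finset.sum_range_succ, ← add_assoc, ih (by omega),
        diagonalStep_omegaOp (hlow _ hs) (by have := hup _ hs; omega), hLJ _ hs]
      ring
  have hle : X (m + 1) (m + 1) + ∑ i ∈ Finset.range (r + 1),
      (reflectionGain m X i (L i) - reflectionExcess m X i (L (i + 1))) ≤
      X (m + 1) (m + 1) + ∑ i ∈ Finset.range (r + 1), diagonalStep X i (T i) := by
    gcongr with i hi
    exact (hT i (by rw [Finset.mem_range] at hi; omega)).2.2
  -- The intervals `(L (i+1), L i]` are consecutive and disjoint, so `m + 1, T 0, …, T r` strictly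
  -- decreases. The extra vertex compensates the larger size: `(m + 1) - (r + 1) = m - r`.
  have key := hX (r + 1) (by omega) (fun i => Nat.casesOn i (m + 1) T) rfl
    (by
      intro i hi
      cases i with
      | zero =>
        have := (hT 0 (by omega)).2.1
        rw [hLJ 0 (by omega), hJ0] at this
        exact Nat.lt_succ_of_le this
      | succ i =>
        exact (hT (i + 1) (by omega)).2.1.trans_lt (hT i (by omega)).1)
    (Nat.one_le_of_lt (hT r le_rfl).1)
  rw [hsum r le_rfl]
  rw [Finset.sum_range_succ, hLr] at hle
  have h0 : reflectionExcess m X r 0 = 0 := if_pos rfl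
  rw [h0] at hle
  push_cast at key
  linarith

/-- The top row is never changed, so its corner obeys the inequality for `X` itself; the lower rows
are handled by the smaller triangle. -/
theorem GOGAmInequalities.omegaProd_apply_self_le {m : ℕ} {X : ℕ → ℕ → ℤ}
    (hX : GOGAmInequalities (m + 1) X) {j : ℕ} (hj : 1 ≤ j) (hjm : j ≤ m + 1) :
    omegaProd m X j j ≤ j := by
  induction m generalizing X with
  | zero =>
    obtain rfl : j = 1 := by omega
    exact hX.1
  | succ m ih =>
    rcases hjm.lt_or_eq with h | rfl
    · exact ih (hX.apply_omegaOp (by omega)) (by omega)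
    · rw [omegaProd_apply_of_lt (by omega)]
      exact hX.1

theorem IsGelfandTsetlin.isGOGAm {n : ℕ} (hn : 1 ≤ n) {X : ℕ → ℕ → ℤ}
    (hX : IsGelfandTsetlin n X) (h : GOGAmInequalities n X) : IsGOGAm n X := by
  obtain ⟨m, rfl⟩ : ∃ m, n = m + 1 := ⟨n - 1, by omega⟩
  exact ⟨hX, hX.omegaProd le_rfl, fun j hj hjm => h.omegaProd_apply_self_le hj hjm⟩

/-! ### The standard procedure -/

/-- The number of inversions of `X` that cover the position `(i, j)`. -/
def coverCount (n : ℕ) (X : ℕ → ℕ → ℤ) (i j : ℕ) : ℕ :=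
  (inversionList n X).countP fun q => decide (Covers n q.1 q.2 i j)

theorem foldl_subtractCovered (n : ℕ) (L : List (ℕ × ℕ)) (Y : ℕ → ℕ → ℤ) (i j : ℕ) :
    L.foldl (subtractCovered n) Y i j =
      Y i j - (L.countP fun q => decide (Covers n q.1 q.2 i j) : ℕ) := by
  induction L generalizing Y with
  | nil => simp
  | cons q L ih =>
    rw [List.foldl_cons, ih, List.countP_cons, subtractCovered]
    by_cases h : Covers n q.1 q.2 i j
    · simp only [h, if_true, decide_true]
      push_cast
      ring
    · simp [h]

theorem standardProcedure_apply (n : ℕ) (X : ℕ → ℕ → ℤ) (i j : ℕ) :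
    standardProcedure n X i j = X i j - coverCount n X i j :=
  foldl_subtractCovered n _ X i j

theorem mem_inversionList {n : ℕ} {X : ℕ → ℕ → ℤ} {i j : ℕ} (h : IsInversion n X i j) :
    (i, j) ∈ inversionList n X := by
  obtain ⟨-, h1, h2, -⟩ := id h
  simp only [inversionList, List.mem_filter, List.mem_flatMap, List.mem_reverse, List.mem_range,
    List.mem_map, decide_eq_true_eq]
  exact ⟨⟨j, by omega, i, by omega, rfl⟩, h⟩

theorem countP_add_one_le_of_mem {α : Type*} {p q : α → Bool} {L : List α}
    (hpq : ∀ x ∈ L, p x → q x) {a : α} (ha : a ∈ L) (hp : ¬ p a) (hq : q a) :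
    L.countP p + 1 ≤ L.countP q := by
  obtain ⟨s, t, rfl⟩ := List.append_of_mem ha
  have h1 := List.countP_mono_left (p := p) (q := q) (l := s) fun x hx => hpq x (by simp [hx])
  have h2 := List.countP_mono_left (p := p) (q := q) (l := t) fun x hx => hpq x (by simp [hx])
  simp only [List.countP_append, List.countP_cons, hp, hq, if_true]
  simp
  omega

theorem Covers.mono {n k l d a b : ℕ} (hab : a ≤ b) (hb : b + d ≤ n)
    (h : Covers n k l (a + d) a) : Covers n k l (b + d) b := by
  obtain ⟨p, hp, h1, h2⟩ := h
  rw [Finset.mem_Icc] at hp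
  exact ⟨p + (b - a), Finset.mem_Icc.2 ⟨by omega, by omega⟩, by omega, by omega⟩

theorem coverCount_mono {n d a b : ℕ} (X : ℕ → ℕ → ℤ) (hab : a ≤ b) (hb : b + d ≤ n) :
    coverCount n X (a + d) a ≤ coverCount n X (b + d) b :=
  List.countP_mono_left fun _ _ h => decide_eq_true ((of_decide_eq_true h).mono hab hb)

/-- An inversion covers the later positions of its diagonal but not its own. -/
theorem coverCount_add_one_le {n d a b : ℕ} {X : ℕ → ℕ → ℤ} (hab : a < b) (hb : b + d ≤ n)
    (h : IsInversion n X (a + d) a) :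
    coverCount n X (a + d) a + 1 ≤ coverCount n X (b + d) b := by
  refine countP_add_one_le_of_mem
    (fun _ _ h => decide_eq_true ((of_decide_eq_true h).mono hab.le hb))
    (mem_inversionList h) ?_ ?_
  · rw [decide_eq_true_eq]
    rintro ⟨p, hp, -, h2⟩
    rw [Finset.mem_Icc] at hp
    simp only at h2
    omega
  · exact decide_eq_true ⟨b - a, Finset.mem_Icc.2 ⟨by omega, by simp only; omega⟩,
      by simp only; omega, by simp only; omega⟩

theorem IsGelfandTsetlin.diagonalStep_add_coverCount_le {n d a b : ℕ} {X : ℕ → ℕ → ℤ}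
    (hX : IsGelfandTsetlin n X) (ha : 1 ≤ a) (hab : a < b) (hb : b + d ≤ n) :
    diagonalStep X d a + coverCount n X (a + d) a + 1 ≤ coverCount n X (b + d) b := by
  have hle := (hX.2 (a + d) a ha (by omega) (by omega)).1
  rw [diagonalStep]
  rcases hle.lt_or_eq with h | h
  · have := coverCount_mono X hab.le hb
    omega
  · have := coverCount_add_one_le (X := X) hab hb ⟨ha, by omega, by omega, h.symm⟩
    omega

theorem IsGelfandTsetlin.gogamInequalities_standardProcedure {n : ℕ} (hn : 1 ≤ n)
    {X : ℕ → ℕ → ℤ} (hX : IsGelfandTsetlin n X) (hnn : X n n = n) :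
    GOGAmInequalities n (standardProcedure n X) := by
  rw [gogamInequalities_iff hn]
  intro r hr J hJ0 hJ hJr
  -- The cover count at the path's current vertex strengthens the bound so that the induction
  -- telescopes.
  have key : ∀ s, s ≤ r → standardProcedure n X n n +
      ∑ i ∈ Finset.range s, diagonalStep (standardProcedure n X) i (J (i + 1)) ≤
      (n : ℤ) - s - coverCount n X (J s + s) (J s) := by
    intro s hs
    induction s with
    | zero => simp [standardProcedure_apply, hnn, hJ0]
    | succ s ih =>
      have h1 := ih (by omega)
      have h2 := hX.diagonalStep_add_coverCount_le (d := s)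
        (hJr.trans (last_le_of_succ_lt hJ hs)) (hJ s hs)
        (hJ0 ▸ add_index_le_of_succ_lt hJ (show s ≤ r by omega))
      rw [Finset.sum_range_succ, diagonalStep, standardProcedure_apply n X (_ + _ + 1),
        standardProcedure_apply n X (J (s + 1) + s)]
      rw [diagonalStep] at h2
      rw [← add_assoc (J (s + 1))]
      push_cast
      linarith
  have := key r le_rfl
  omega

theorem mainTheorem3 (n : ℕ) (hn : 1 ≤ n) (X : ℕ → ℕ → ℤ) (hX : IsGog n X) :
    GOGAmInequalities n (standardProcedure n X) ∧
    (IsGelfandTsetlin n (standardProcedure n X) → IsGOGAm n (standardProcedure n X)) ∧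
    (IsAdmissible n X → IsGOGAm n (standardProcedure n X)) := by
  have h := hX.1.gogamInequalities_standardProcedure hn (hX.2.2 n hn le_rfl)
  refine ⟨h, fun hY => hY.isGOGAm hn h, fun hA => IsGelfandTsetlin.isGOGAm hn ?_ h⟩
  have := hA _ le_rfl
  rwa [standardStep, List.take_length] at this
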